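/- Let $h_0\colon[-e^{-1},e^{-1}]\to\mathbb R$ be given by $h_0(x)=|x|\,\bigl(\log\bigl|\log\frac{|x|}{e}\bigr|\bigr)^{-1/2}$ for $x\neq 0$ and $h_0(0)=0$; it is a $C^1$-function. Let $\ell^2_N$ denote $\mathbb C^N$ with its standard Hilbert space structure and let $\|\cdot\|_\infty$ denote the operator norm on $B(\ell^2_N)$. There is a constant $c>0$ such that for every $2\pi$-periodic $C^1$-function $h\colon\mathbb R\to\mathbb R$ with $h=h_0$ on $[-e^{-1},e^{-1}]$ and every integer $n\geq 3$, there exist self-adjoint operators $A_n,B_n\in B(\ell^2_{2n+1})$ such that $B_n\neq 0$, $0\in\sigma(A_n)$, $$\|h(A_n+B_n)-h(A_n)\|_\infty\ \geq\ c\,(\log n)^{1/2}\,\|B_n\|_\infty ,$$ and there exists a unitary operator $S_n\in B(\ell^2_{2n+1})$ with $A_n+B_n=S_n^{-1}A_nS_n$. Here $h(A_n)$ and $h(A_n+B_n)$ are defined by the functional calculus of self-adjoint operators. -/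

import Mathlib

/-- The space `B(ℓ²_N)` of operators on `ℂ^N` with its standard Hilbert space structure.
Its norm is the operator norm, i.e. the Schatten `∞`-norm. -/
abbrev OpL2 (N : ℕ) : Type :=
  EuclideanSpace ℂ (Fin N) →L[ℂ] EuclideanSpace ℂ (Fin N)

/-- The function `x ↦ |x| (log |log (|x| / e)|) ^ (-1/2)`, with value `0` at `0`. It is only
used on the interval `[-e⁻¹, e⁻¹]`, on which `|log (|x| / e)| ≥ 2` for `x ≠ 0`. -/
noncomputable def hFormula (x : ℝ) : ℝ :=
  if x = 0 then 0
  else |x| * (Real.log |Real.log (|x| / Real.exp 1)|) ^ (-(1 / 2) : ℝ)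

/-- `h` is a `2π`-periodic `C¹` function on `ℝ` which extends the restriction of `hFormula`
to `[-e⁻¹, e⁻¹]`. -/
structure IsPeriodicExtension (h : ℝ → ℝ) : Prop where
  contDiff : ContDiff ℝ 1 h
  periodic : Function.Periodic h (2 * Real.pi)
  eqOn : Set.EqOn h hFormula (Set.Icc (-(Real.exp 1)⁻¹) (Real.exp 1)⁻¹)

/-!
For self-adjoint `x`, the derivative at `t = 0` of `exp (-itx) c exp (itx)` is `i [c, x]`. Hence a
strict inequality `K ‖[a, x]‖ < ‖[f(a), x]‖` passes to `K ‖b‖ < ‖f(a + b) - f(a)‖` for the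
perturbation `a + b = exp (-itx) a exp (itx)` with a small `t`. If `a` is diagonal and
`G = [a, x]`, then `[f(a), x]` is the Schur product of `G` with the matrix of divided differences
of `f` at the eigenvalues of `a`, so it remains to find a skew-adjoint contraction `G` for which
this Schur product is large.

Take the eigenvalues `exp (-(i + 1))` and `-exp (-(i + 1))`, `i < n`. Since `h₀` is even, its
divided difference at `exp (-(i + 1))` and `-exp (-(j + 1))` has the sign of `j - i` and absolute
value at least `(log n) ^ (-1/2) / 3` for `i ≠ j`. Let `G` couple the positive to the negative
eigenvalues by a unitary matrix whose entries have the sign of `j - i` and size comparable to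
`1 / |j - i|`. The Schur product then has no cancellation, and the harmonic series bounds its row
sums below by a multiple of `(log n) ^ (-1/2) * log n`.
-/

section UnitaryConjugation

open Complex Filter Topology selfAdjoint

variable {𝔄 : Type*} [CStarAlgebra 𝔄]

theorem hasDerivAt_star_expUnitary_mul_mul (x : selfAdjoint 𝔄) (c : 𝔄) :
    HasDerivAt (fun t : ℝ ↦ star (expUnitary (t • x) : 𝔄) * c * (expUnitary (t • x) : 𝔄))
      (I • (c * x - x * c)) 0 := by
  have hexp : HasDerivAt (fun t : ℝ ↦ (expUnitary (t • x) : 𝔄)) (I • (x : 𝔄)) 0 := by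
    simpa [smul_comm I] using hasDerivAt_exp_smul_const (I • (x : 𝔄)) (0 : ℝ)
  refine ((hexp.star.mul_const c).fun_mul hexp).congr_deriv ?_
  simp only [star_smul, RCLike.star_def, conj_I, x.2.star_eq, zero_smul, expUnitary_zero,
    OneMemClass.coe_one, star_one, one_mul, mul_one, neg_smul, neg_mul, smul_mul_assoc,
    mul_smul_comm, smul_sub]
  abel

theorem exists_unitary_norm_conj_sub_lt {a b x : 𝔄} (hx : IsSelfAdjoint x) {K : ℝ}
    (hlt : K * ‖a * x - x * a‖ < ‖b * x - x * b‖) :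
    ∃ s : unitary 𝔄, K * ‖star (s : 𝔄) * a * s - a‖ < ‖star (s : 𝔄) * b * s - b‖ := by
  lift x to selfAdjoint 𝔄 using hx
  have hslope (c : 𝔄) := (hasDerivAt_star_expUnitary_mul_mul x c).tendsto_slope_zero.norm
  simp only [zero_add, zero_smul, expUnitary_zero, OneMemClass.coe_one, star_one, one_mul, mul_one,
    norm_smul, norm_I] at hslope
  obtain ⟨t, hlt_t, ht⟩ := (((hslope a).const_mul K).eventually_lt (hslope b) hlt).and
    self_mem_nhdsWithin |>.exists
  rw [mul_left_comm, mul_lt_mul_iff_of_pos_left (norm_pos_iff.2 (inv_ne_zero ht))] at hlt_t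
  exact ⟨_, hlt_t⟩

theorem cfc_star_mul_mul {f : ℝ → ℝ} {a : 𝔄} (hf : ContinuousOn f (spectrum ℝ a))
    (ha : IsSelfAdjoint a) (s : unitary 𝔄) :
    cfc f (star (s : 𝔄) * a * s) = star (s : 𝔄) * cfc f a * s := by
  have hconj : ⇑(Unitary.conjStarAlgAut ℂ 𝔄 (star s)) = fun c ↦ star (s : 𝔄) * c * s :=
    funext (Unitary.conjStarAlgAut_star_apply s)
  have hmap := StarAlgHomClass.map_cfc (S := ℂ) (Unitary.conjStarAlgAut ℂ 𝔄 (star s)) f a hf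
    (by rw [hconj]; fun_prop) ha (ha.map _)
  rw [hconj] at hmap
  exact hmap.symm

end UnitaryConjugation

section DiagonalOperators

open Complex Matrix

theorem isSelfAdjoint_ofReal_comp {ι : Type*} (d : ι → ℝ) :
    IsSelfAdjoint fun i ↦ (d i : ℂ) :=
  funext fun i ↦ conj_ofReal (d i)

theorem spectrum_starAlgHom_ofReal_subset {ι 𝔄 : Type*} [Ring 𝔄] [Star 𝔄] [Algebra ℂ 𝔄]
    [Algebra ℝ 𝔄] [IsScalarTower ℝ ℂ 𝔄] (ψ : (ι → ℂ) →⋆ₐ[ℂ] 𝔄) (d : ι → ℝ) :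
    spectrum ℝ (ψ fun i ↦ (d i : ℂ)) ⊆ Set.range d := by
  intro r hr
  have hmem := AlgHom.spectrum_apply_subset ψ _ ((spectrum.algebraMap_mem_iff ℂ).2 hr)
  simpa [Pi.spectrum_eq, spectrum.mem_iff, sub_eq_zero, eq_comm, ← Complex.ofReal_sub] using hmem

theorem cfc_starAlgHom_ofReal {ι 𝔄 : Type*} [Finite ι] [CStarAlgebra 𝔄] (ψ : (ι → ℂ) →⋆ₐ[ℂ] 𝔄)
    (f : ℝ → ℝ) (d : ι → ℝ) : cfc f (ψ fun i ↦ (d i : ℂ)) = ψ fun i ↦ (f (d i) : ℂ) := by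
  classical
  obtain ⟨p, hp⟩ : ∃ p : Polynomial ℝ, ∀ i, p.eval (d i) = f (d i) :=
    ⟨Lagrange.interpolate (Set.finite_range d).toFinset id f,
      fun i ↦ Lagrange.eval_interpolate_at_node f Function.injective_id.injOn (by simp)⟩
  calc cfc f (ψ fun i ↦ (d i : ℂ)) = cfc p.eval (ψ fun i ↦ (d i : ℂ)) := by
        refine cfc_congr fun r hr ↦ ?_
        obtain ⟨i, rfl⟩ := spectrum_starAlgHom_ofReal_subset ψ d hr
        exact (hp i).symm
    _ = Polynomial.aeval (ψ fun i ↦ (d i : ℂ)) p :=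
        cfc_polynomial p _ ((isSelfAdjoint_ofReal_comp d).map ψ)
    _ = ψ (Polynomial.aeval (fun i ↦ (d i : ℂ)) p) :=
        Polynomial.aeval_algHom_apply (ψ.toAlgHom.restrictScalars ℝ) _ p
    _ = ψ fun i ↦ (f (d i) : ℂ) := by
        congr 1
        ext i
        rw [Polynomial.aeval_pi_apply₂]
        exact (Polynomial.aeval_algebraMap_apply_eq_algebraMap_eval (d i) p).trans
          (congrArg _ (hp i))

theorem exists_unitary_norm_cfc_conj_sub {ι 𝔄 : Type*} [Finite ι] [CStarAlgebra 𝔄]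
    (ψ : (ι → ℂ) →⋆ₐ[ℂ] 𝔄) (f : ℝ → ℝ) (d : ι → ℝ) {x : 𝔄} (hx : IsSelfAdjoint x) {K : ℝ}
    (hlt : K * ‖ψ (fun i ↦ (d i : ℂ)) * x - x * ψ fun i ↦ (d i : ℂ)‖ <
      ‖ψ (fun i ↦ (f (d i) : ℂ)) * x - x * ψ fun i ↦ (f (d i) : ℂ)‖) :
    ∃ s : unitary 𝔄, ∀ h : ℝ → ℝ, Set.EqOn h f (Set.range d) →
      K * ‖star (s : 𝔄) * ψ (fun i ↦ (d i : ℂ)) * s - ψ fun i ↦ (d i : ℂ)‖ <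
        ‖cfc h (star (s : 𝔄) * ψ (fun i ↦ (d i : ℂ)) * s) - cfc h (ψ fun i ↦ (d i : ℂ))‖ := by
  obtain ⟨s, hs⟩ := exists_unitary_norm_conj_sub_lt hx hlt
  refine ⟨s, fun h hh ↦ ?_⟩
  have hcont : ContinuousOn h (spectrum ℝ (ψ fun i ↦ (d i : ℂ))) :=
    ((Set.finite_range d).subset (spectrum_starAlgHom_ofReal_subset ψ d)).continuousOn h
  have hhf : (fun i ↦ (h (d i) : ℂ)) = fun i ↦ (f (d i) : ℂ) :=
    funext fun i ↦ congrArg _ (hh ⟨i, rfl⟩)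
  rwa [cfc_star_mul_mul hcont ((isSelfAdjoint_ofReal_comp d).map ψ), cfc_starAlgHom_ofReal, hhf]

variable {ι : Type*}

/-- The Loewner matrix of divided differences of `f` at the points `d i`, with the junk value `0`
instead of a derivative at the pairs with `d i = d j`. -/
noncomputable def loewnerMatrix (f : ℝ → ℝ) (d : ι → ℝ) : Matrix ι ι ℂ :=
  of fun i j ↦ (slope f (d i) (d j) : ℂ)

/-- The matrix `X` with `[diagonal d, X] = G`, for a matrix `G` that vanishes at the pairs with
`d i = d j`. -/
noncomputable def commutatorPreimage (d : ι → ℝ) (G : Matrix ι ι ℂ) : Matrix ι ι ℂ :=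
  of fun i j ↦ G i j / (d i - d j : ℝ)

theorem isSelfAdjoint_commutatorPreimage (d : ι → ℝ) {G : Matrix ι ι ℂ} (hG : Gᴴ = -G) :
    IsSelfAdjoint (commutatorPreimage d G) := by
  ext i j
  have hij : star (G j i) = -G i j := congrFun₂ hG i j
  rw [star_apply, commutatorPreimage, of_apply, of_apply, star_div₀, hij, RCLike.star_def,
    conj_ofReal, ← neg_div_neg_eq, neg_neg, ← ofReal_neg, neg_sub]

theorem loewnerMatrix_id_hadamard {d : ι → ℝ} {G : Matrix ι ι ℂ}
    (hdG : ∀ i j, d i = d j → G i j = 0) : loewnerMatrix id d ⊙ G = G := by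
  ext i j
  rw [hadamard_apply, loewnerMatrix, of_apply, slope_def_field]
  obtain hij | hij := eq_or_ne (d i) (d j)
  · rw [hdG i j hij, mul_zero]
  · rw [id, id, div_self (sub_ne_zero.2 hij.symm), ofReal_one, one_mul]

variable [Fintype ι] [DecidableEq ι]

theorem commutator_diagonal_commutatorPreimage (f : ℝ → ℝ) (d : ι → ℝ) (G : Matrix ι ι ℂ) :
    diagonal (fun i ↦ (f (d i) : ℂ)) * commutatorPreimage d G -
        commutatorPreimage d G * diagonal (fun i ↦ (f (d i) : ℂ)) =
      loewnerMatrix f d ⊙ G := by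
  ext i j
  rw [Matrix.sub_apply, diagonal_mul, mul_diagonal, hadamard_apply, loewnerMatrix, of_apply,
    slope_comm, slope_def_field, commutatorPreimage, of_apply]
  push_cast
  ring

/-- The embedding of functions as diagonal matrices, as a homomorphism of star algebras. -/
def diagonalStarAlgHom (ι : Type*) [Fintype ι] [DecidableEq ι] :
    (ι → ℂ) →⋆ₐ[ℂ] Matrix ι ι ℂ where
  __ := Matrix.diagonalAlgHom (n := ι) (α := ℂ) ℂ
  map_star' v := by simp [star_eq_conjTranspose, diagonal_conjTranspose]

open scoped Matrix.Norms.L2Operator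

theorem exists_perturbation_of_mul_norm_lt_norm_loewnerMatrix_hadamard {𝔄 : Type*}
    [CStarAlgebra 𝔄] {φ : Matrix ι ι ℂ →⋆ₐ[ℂ] 𝔄} (hφ : Function.Injective φ) (f : ℝ → ℝ)
    {d : ι → ℝ} {G : Matrix ι ι ℂ} (hG : Gᴴ = -G) (hdG : ∀ i j, d i = d j → G i j = 0) {K : ℝ}
    (hlt : K * ‖G‖ < ‖loewnerMatrix f d ⊙ G‖) {a : 𝔄} (ha : φ (diagonal fun i ↦ (d i : ℂ)) = a) :
    ∃ b : 𝔄, IsSelfAdjoint b ∧ b ≠ 0 ∧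
      (∀ h : ℝ → ℝ, Set.EqOn h f (Set.range d) → K * ‖b‖ < ‖cfc h (a + b) - cfc h a‖) ∧
      ∃ s : unitary 𝔄, a + b = (s⁻¹ : unitary 𝔄) * a * s := by
  have hnorm (g : ℝ → ℝ) :
      ‖φ (diagonal fun i ↦ (g (d i) : ℂ)) * φ (commutatorPreimage d G) -
        φ (commutatorPreimage d G) * φ (diagonal fun i ↦ (g (d i) : ℂ))‖ =
      ‖loewnerMatrix g d ⊙ G‖ := by
    rw [← map_mul, ← map_mul, ← map_sub, commutator_diagonal_commutatorPreimage,
      NonUnitalStarAlgHom.norm_map φ hφ]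
  have hid := hnorm id
  rw [loewnerMatrix_id_hadamard hdG] at hid
  obtain ⟨s, hs⟩ := exists_unitary_norm_cfc_conj_sub (φ.comp (diagonalStarAlgHom ι)) f d
    ((isSelfAdjoint_commutatorPreimage d hG).map φ)
    ((congrArg (K * ·) hid).trans_lt (hlt.trans_eq (hnorm f).symm))
  have hd : φ.comp (diagonalStarAlgHom ι) (fun i ↦ (d i : ℂ)) = a := ha
  simp only [hd] at hs
  have ha' : IsSelfAdjoint a := hd ▸ (isSelfAdjoint_ofReal_comp d).map _
  have hconj : a + (star (s : 𝔄) * a * s - a) = star (s : 𝔄) * a * s := add_sub_cancel _ _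
  refine ⟨star (s : 𝔄) * a * s - a, (ha'.conjugate' _).sub ha', fun h₀ ↦ ?_, ?_, s, hconj⟩
  · simpa [sub_eq_zero.1 h₀] using hs f fun _ _ ↦ rfl
  · rwa [hconj]

end DiagonalOperators

section DiscreteHilbertMatrix

open Complex Matrix

theorem sum_exp_odd_mul_mul_sin (θ : ℂ) (n : ℕ) :
    (∑ k ∈ Finset.range n, exp ((2 * k + 1) * θ * I)) * (2 * I * sin θ) =
      exp (2 * n * θ * I) - 1 := by
  have hsin : 2 * I * sin θ = exp (θ * I) - exp (-(θ * I)) := by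
    rw [Complex.sin, neg_mul]
    linear_combination (exp (-(θ * I)) - exp (θ * I)) * I_mul_I
  have hterm (k : ℕ) : exp ((2 * k + 1) * θ * I) * (2 * I * sin θ) =
      exp (2 * (k + 1 : ℕ) * θ * I) - exp (2 * k * θ * I) := by
    rw [hsin, mul_sub, ← exp_add, ← exp_add]
    push_cast
    ring_nf
  rw [Finset.sum_mul, Finset.sum_congr rfl fun k _ ↦ hterm k,
    Finset.sum_range_sub fun k : ℕ ↦ exp (2 * k * θ * I)]
  simp

theorem sin_pi_mul_sub_add_div_ne_zero {n : ℕ} (i j : Fin n) {t : ℝ} (ht : |t| < 1)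
    (hne : (j - i + t : ℝ) ≠ 0) : Real.sin (Real.pi * (j - i + t) / n) ≠ 0 := by
  have hn : (0 : ℝ) < n := Nat.cast_pos.2 i.pos
  have hi : (i + 1 : ℝ) ≤ n := mod_cast i.is_lt
  have hj : (j + 1 : ℝ) ≤ n := mod_cast j.is_lt
  have hi₀ : (0 : ℝ) ≤ i := Nat.cast_nonneg _
  have hj₀ : (0 : ℝ) ≤ j := Nat.cast_nonneg _
  have hpi := Real.pi_pos
  rw [abs_lt] at ht
  rw [Ne, Real.sin_eq_zero_iff_of_lt_of_lt]
  · positivity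
  · rw [lt_div_iff₀ hn]; nlinarith
  · rw [div_lt_iff₀ hn]; nlinarith

theorem natCast_sub_add_half_ne_zero (i j : ℕ) : (j - i + 1 / 2 : ℝ) ≠ 0 := by
  intro h
  have : (2 * (j - i) + 1 : ℤ) = 0 := by
    rify
    linarith
  omega

/-- The matrix of the exponentials with frequencies `2 k + 1` at the points `π (j + t) / n`. For the
shifts `t = 0` and `t = 1 / 2` its columns are two orthonormal bases of `ℂⁿ`, and the discrete
Hilbert matrix is the change of basis between them, up to a factor `I`. -/
noncomputable def shiftedFourierMatrix (n : ℕ) (t : ℝ) : Matrix (Fin n) (Fin n) ℂ :=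
  of fun k j ↦ ((√n : ℝ) : ℂ)⁻¹ * exp ((2 * (k : ℕ) + 1) * (Real.pi * (j + t) / n : ℝ) * I)

/-- The matrix with entries `1 / (n sin (π (j - i + 1/2) / n))`, a periodic variant of the Hilbert
matrix `1 / (π (j - i + 1/2))` that is exactly unitary. -/
noncomputable def discreteHilbertMatrix (n : ℕ) : Matrix (Fin n) (Fin n) ℝ :=
  of fun i j ↦ (n * Real.sin (Real.pi * (j - i + 1 / 2) / n))⁻¹

theorem conjTranspose_shiftedFourierMatrix_mul_apply (n : ℕ) (s t : ℝ) (i j : Fin n) :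
    ((shiftedFourierMatrix n s)ᴴ * shiftedFourierMatrix n t) i j =
      (n : ℂ)⁻¹ * ∑ k ∈ Finset.range n,
        exp ((2 * k + 1) * (Real.pi * (j - i + (t - s)) / n : ℝ) * I) := by
  have hsqrt : ((√n : ℝ) : ℂ)⁻¹ * ((√n : ℝ) : ℂ)⁻¹ = (n : ℂ)⁻¹ := by
    rw [← mul_inv, ← ofReal_mul, Real.mul_self_sqrt n.cast_nonneg, ofReal_natCast]
  rw [Matrix.mul_apply, ← Fin.sum_univ_eq_sum_range fun k ↦
    exp ((2 * k + 1) * (Real.pi * (j - i + (t - s)) / n : ℝ) * I), Finset.mul_sum]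
  refine Finset.sum_congr rfl fun k _ ↦ ?_
  simp only [conjTranspose_apply, shiftedFourierMatrix, of_apply, star_mul', RCLike.star_def,
    map_inv₀, conj_ofReal, ← exp_conj, map_mul, map_add, map_natCast, map_one, conj_I, map_ofNat]
  rw [mul_mul_mul_comm, hsqrt, ← exp_add]
  push_cast
  ring_nf

theorem conjTranspose_shiftedFourierMatrix_mul_self (n : ℕ) (t : ℝ) :
    (shiftedFourierMatrix n t)ᴴ * shiftedFourierMatrix n t = 1 := by
  ext i j
  have hn : (n : ℂ) ≠ 0 := Nat.cast_ne_zero.2 i.pos.ne'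
  rw [conjTranspose_shiftedFourierMatrix_mul_apply, sub_self, add_zero]
  obtain rfl | hij := eq_or_ne i j
  · simp [hn]
  have hsin : Real.sin (Real.pi * (j - i) / n) ≠ 0 := by
    have hne : (j - i : ℝ) ≠ 0 := sub_ne_zero.2 (mod_cast (Fin.val_injective.ne hij).symm)
    simpa using sin_pi_mul_sub_add_div_ne_zero i j (t := 0) (by simp) (by simpa using hne)
  have hperiod : exp (2 * n * (Real.pi * (j - i) / n : ℝ) * I) = 1 := by
    refine exp_eq_one_iff.2 ⟨(j : ℤ) - i, ?_⟩
    push_cast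
    field_simp
  have hsum := sum_exp_odd_mul_mul_sin (Real.pi * (j - i) / n : ℝ) n
  rw [hperiod, sub_self, ← ofReal_sin] at hsum
  rw [(mul_eq_zero.1 hsum).resolve_right (by simpa using ofReal_ne_zero.2 hsin), mul_zero,
    one_apply_ne hij]

theorem I_smul_discreteHilbertMatrix (n : ℕ) :
    I • (discreteHilbertMatrix n).map ofReal =
      (shiftedFourierMatrix n 0)ᴴ * shiftedFourierMatrix n (1 / 2) := by
  ext i j
  have hn : (n : ℂ) ≠ 0 := Nat.cast_ne_zero.2 i.pos.ne'
  set θ : ℝ := Real.pi * (j - i + 1 / 2) / n with hθ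
  have hsin : (Real.sin θ : ℂ) ≠ 0 := ofReal_ne_zero.2 <|
    sin_pi_mul_sub_add_div_ne_zero i j (by norm_num [abs_lt])
      (natCast_sub_add_half_ne_zero i j)
  have hperiod : exp (2 * n * (θ : ℂ) * I) = -1 := by
    rw [← exp_pi_mul_I]
    refine exp_eq_exp_iff_exists_int.2 ⟨(j : ℤ) - i, ?_⟩
    push_cast [hθ]
    field_simp
    ring
  have hsum := sum_exp_odd_mul_mul_sin θ n
  rw [hperiod, ← ofReal_sin] at hsum
  rw [conjTranspose_shiftedFourierMatrix_mul_apply, sub_zero, ← hθ, Matrix.smul_apply, map_apply,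
    discreteHilbertMatrix, of_apply, ← hθ, smul_eq_mul, ofReal_inv, ofReal_mul, ofReal_natCast]
  generalize (∑ k ∈ Finset.range n, exp ((2 * k + 1) * θ * I)) = σ at hsum ⊢
  field_simp
  linear_combination (I / 2) * hsum - σ * (Real.sin θ : ℂ) * I_sq

theorem discreteHilbertMatrix_mem_unitaryGroup (n : ℕ) :
    (discreteHilbertMatrix n).map ofReal ∈ unitaryGroup (Fin n) ℂ := by
  set H := (discreteHilbertMatrix n).map ofReal
  have hF (t : ℝ) : shiftedFourierMatrix n t ∈ unitaryGroup (Fin n) ℂ :=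
    mem_unitaryGroup_iff'.2 (conjTranspose_shiftedFourierMatrix_mul_self n t)
  have hI : -I ∈ unitary ℂ := by simp [Unitary.mem_iff]
  have hH : H = (-I) • (I • H) := by simp [smul_smul]
  rw [hH, I_smul_discreteHilbertMatrix]
  exact Unitary.smul_mem_of_mem hI (mul_mem (Unitary.star_mem (hF 0)) (hF (1 / 2)))

end DiscreteHilbertMatrix

section Estimates

theorem log_le_sum_range_inv (n : ℕ) :
    Real.log (n + 1) ≤ ∑ j ∈ Finset.range n, ((j : ℝ) + 1)⁻¹ := by
  simpa [harmonic] using log_add_one_le_harmonic n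

theorem log_le_sum_inv_abs_sub {n i : ℕ} (hi : i < n) :
    Real.log n ≤ ∑ j ∈ Finset.range n, |(j - i : ℝ)|⁻¹ := by
  obtain ⟨m, rfl⟩ : ∃ m, n = i + (m + 1) := ⟨n - i - 1, by omega⟩
  have hleft : ∑ j ∈ Finset.range i, |(j - i : ℝ)|⁻¹ =
      ∑ j ∈ Finset.range i, ((j : ℝ) + 1)⁻¹ := by
    rw [← Finset.sum_range_reflect (fun j ↦ ((j : ℝ) + 1)⁻¹) i]
    refine Finset.sum_congr rfl fun j hj ↦ ?_
    have hj' : j + 1 ≤ i := Finset.mem_range.1 hj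
    have hji : (j + 1 : ℝ) ≤ i := mod_cast hj'
    rw [Nat.sub_sub, add_comm 1 j, Nat.cast_sub hj', abs_sub_comm, abs_of_pos (by linarith)]
    push_cast
    ring
  have hright : ∑ j ∈ Finset.range (m + 1), |((i + j : ℕ) - i : ℝ)|⁻¹ =
      ∑ j ∈ Finset.range m, ((j : ℝ) + 1)⁻¹ := by
    rw [Finset.sum_range_succ']
    simp [abs_of_nonneg, add_nonneg]
  calc Real.log (i + (m + 1) : ℕ) ≤ Real.log ((i + 1) * (m + 1)) := by
        apply Real.log_le_log (by positivity)
        push_cast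
        nlinarith [mul_nonneg (Nat.cast_nonneg (α := ℝ) i) (Nat.cast_nonneg (α := ℝ) m)]
    _ = Real.log (i + 1) + Real.log (m + 1) := Real.log_mul (by positivity) (by positivity)
    _ ≤ _ := add_le_add (log_le_sum_range_inv i) (log_le_sum_range_inv m)
    _ = _ := by rw [Finset.sum_range_add, hleft, hright]

theorem inv_pi_mul_le_inv_mul_sin {r x : ℝ} (hx : 0 < x) (hxr : x < r) :
    (Real.pi * x)⁻¹ ≤ (r * Real.sin (Real.pi * x / r))⁻¹ := by
  have hr : 0 < r := hx.trans hxr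
  have hpi := Real.pi_pos
  have hsin : 0 < Real.sin (Real.pi * x / r) :=
    Real.sin_pos_of_pos_of_lt_pi (by positivity) (by rw [div_lt_iff₀ hr]; nlinarith)
  refine inv_anti₀ (by positivity) ?_
  rw [← le_div_iff₀' hr]
  exact Real.sin_le (by positivity)

theorem le_discreteHilbertMatrix {n : ℕ} {i j : Fin n} (hij : i < j) :
    2 / (3 * Real.pi) * |(j - i : ℝ)|⁻¹ ≤ discreteHilbertMatrix n i j := by
  have hij' : (i + 1 : ℝ) ≤ j := mod_cast hij
  have hj : (j + 1 : ℝ) ≤ n := mod_cast j.is_lt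
  refine le_trans ?_ (inv_pi_mul_le_inv_mul_sin (by linarith) (by linarith))
  rw [abs_of_pos (by linarith), ← inv_div, ← mul_inv]
  have hpi := Real.pi_pos
  refine inv_anti₀ (mul_pos hpi (by linarith)) ?_
  nlinarith

theorem discreteHilbertMatrix_le {n : ℕ} {i j : Fin n} (hij : j < i) :
    discreteHilbertMatrix n i j ≤ -(2 / (3 * Real.pi) * |(j - i : ℝ)|⁻¹) := by
  have hij' : (j + 1 : ℝ) ≤ i := mod_cast hij
  have hi : (i + 1 : ℝ) ≤ n := mod_cast i.is_lt
  have hneg : discreteHilbertMatrix n i j =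
      -(n * Real.sin (Real.pi * (i - j - 1 / 2) / n))⁻¹ := by
    rw [discreteHilbertMatrix, Matrix.of_apply, ← inv_neg, ← mul_neg, ← Real.sin_neg]
    ring_nf
  rw [hneg, neg_le_neg_iff]
  refine le_trans ?_ (inv_pi_mul_le_inv_mul_sin (by linarith) (by linarith))
  rw [abs_sub_comm, abs_of_pos (by linarith), ← inv_div, ← mul_inv]
  have hpi := Real.pi_pos
  refine inv_anti₀ (mul_pos hpi (by linarith)) ?_
  nlinarith

theorem hFormula_neg (x : ℝ) : hFormula (-x) = hFormula x := by
  simp [hFormula]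

theorem hFormula_exp_neg (k : ℕ) :
    hFormula (Real.exp (-(k + 1))) = Real.exp (-(k + 1)) * (√(Real.log (k + 2)))⁻¹ := by
  have habs : |-(k + 1 : ℝ) - 1| = k + 2 := by
    rw [abs_of_neg (by linarith [k.cast_nonneg (α := ℝ)])]
    ring
  rw [hFormula, if_neg (Real.exp_ne_zero _), abs_of_pos (Real.exp_pos _), ← Real.exp_sub,
    Real.log_exp, habs, Real.rpow_neg (Real.log_nonneg (by linarith [k.cast_nonneg (α := ℝ)])),
    Real.sqrt_eq_rpow]

theorem slope_neg_eq_neg_slope_neg {k E : Type*} [Field k] [AddCommGroup E] [Module k E]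
    {f : k → E} (hf : f.Even) (x y : k) : slope f x (-y) = -slope f y (-x) := by
  rw [slope, slope, hf, hf, vsub_eq_sub, vsub_eq_sub, ← smul_neg, neg_sub, neg_sub_left,
    neg_sub_left, add_comm]

theorem le_slope_hFormula {n i j : ℕ} (hij : i < j) (hj : j < n) :
    1 / 3 * (√(Real.log n))⁻¹ ≤
      slope hFormula (Real.exp (-(i + 1))) (-Real.exp (-(j + 1))) := by
  have hij' : (i + 1 : ℝ) ≤ j := mod_cast hij
  have hj' : (j + 1 : ℝ) ≤ n := mod_cast hj
  have hlog : 0 < Real.log (i + 2) := Real.log_pos (by linarith)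
  have hsqrt {x : ℝ} (hx : i + 2 ≤ x) : (√(Real.log x))⁻¹ ≤ (√(Real.log (i + 2)))⁻¹ :=
    inv_anti₀ (Real.sqrt_pos.2 hlog) (Real.sqrt_le_sqrt (Real.log_le_log (by linarith) hx))
  have hexp : 2 * Real.exp (-(j + 1)) ≤ Real.exp (-(i + 1)) :=
    calc 2 * Real.exp (-(j + 1)) ≤ Real.exp (j - i) * Real.exp (-(j + 1)) := by
          gcongr
          linarith [Real.add_one_le_exp (j - i : ℝ)]
      _ = Real.exp (-(i + 1)) := by rw [← Real.exp_add]; ring_nf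
  rw [slope_comm, slope_def_field, hFormula_neg, hFormula_exp_neg, hFormula_exp_neg,
    sub_neg_eq_add, le_div_iff₀ (by positivity)]
  have hu := Real.exp_pos (-(i + 1))
  have hv := Real.exp_pos (-(j + 1))
  have hn := hsqrt (x := n) (by linarith)
  have hq := hsqrt (x := j + 2) (by linarith)
  have hp : 0 ≤ (√(Real.log n))⁻¹ := by positivity
  set u := Real.exp (-(i + 1))
  set v := Real.exp (-(j + 1))
  set p := (√(Real.log (i + 2)))⁻¹
  calc 1 / 3 * (√(Real.log n))⁻¹ * (u + v) ≤ (√(Real.log n))⁻¹ * (u - v) := by nlinarith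
    _ ≤ p * (u - v) := by gcongr; linarith
    _ ≤ u * p - v * (√(Real.log (j + 2)))⁻¹ := by nlinarith

theorem le_slope_hFormula_mul_discreteHilbertMatrix {n : ℕ} (i j : Fin n) :
    2 / (9 * Real.pi) * (√(Real.log n))⁻¹ * |(j - i : ℝ)|⁻¹ ≤
      slope hFormula (Real.exp (-(i + 1))) (-Real.exp (-(j + 1))) *
        discreteHilbertMatrix n i j := by
  have hfactor : 2 / (9 * Real.pi) * (√(Real.log n))⁻¹ * |(j - i : ℝ)|⁻¹ =
      1 / 3 * (√(Real.log n))⁻¹ * (2 / (3 * Real.pi) * |(j - i : ℝ)|⁻¹) := by ring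
  rw [hfactor]
  obtain hij | rfl | hij := lt_trichotomy i j
  · have hslope := le_slope_hFormula hij j.is_lt
    exact mul_le_mul hslope (le_discreteHilbertMatrix hij) (by positivity)
      (le_trans (by positivity) hslope)
  · simp [slope_def_field, hFormula_neg]
  · have hslope := le_slope_hFormula hij i.is_lt
    rw [slope_neg_eq_neg_slope_neg hFormula_neg, neg_mul, ← mul_neg]
    exact mul_le_mul hslope (le_neg.1 (discreteHilbertMatrix_le hij)) (by positivity)
      (le_trans (by positivity) hslope)

end Estimates

section LacunaryOperators

open Matrix
open scoped Matrix.Norms.L2Operator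

theorem norm_sum_sum_apply_le {m n : Type*} [Fintype m] [Fintype n] [DecidableEq n]
    (M : Matrix m n ℂ) (s : Finset m) (t : Finset n) :
    ‖∑ i ∈ s, ∑ j ∈ t, M i j‖ ≤ √s.card * √t.card * ‖M‖ := by
  classical
  let u : EuclideanSpace ℂ m := WithLp.toLp 2 fun i ↦ if i ∈ s then 1 else 0
  let v : EuclideanSpace ℂ n := WithLp.toLp 2 fun j ↦ if j ∈ t then 1 else 0
  have hu : ‖u‖ = √s.card := by simp [u, EuclideanSpace.norm_eq, apply_ite norm, ite_pow]
  have hv : ‖v‖ = √t.card := by simp [v, EuclideanSpace.norm_eq, apply_ite norm, ite_pow]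
  have hinner : ∑ i ∈ s, ∑ j ∈ t, M i j = inner ℂ u (WithLp.toLp 2 (M *ᵥ v.ofLp)) := by
    simp [u, v, EuclideanSpace.inner_toLp_toLp, dotProduct, mulVec]
  calc ‖∑ i ∈ s, ∑ j ∈ t, M i j‖ ≤ ‖u‖ * ‖WithLp.toLp 2 (M *ᵥ v.ofLp)‖ :=
        hinner ▸ norm_inner_le_norm _ _
    _ ≤ ‖u‖ * (‖M‖ * ‖v‖) := by gcongr; exact M.l2_opNorm_mulVec v
    _ = √s.card * √t.card * ‖M‖ := by rw [hu, hv]; ring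

/-- The eigenvalues `exp (-(i + 1))`, `-exp (-(i + 1))` for `i < n`, and `0`. -/
noncomputable def lacunaryEigenvalues (n : ℕ) : (Fin n ⊕ Fin n) ⊕ Unit → ℝ :=
  Sum.elim (Sum.elim (fun i ↦ Real.exp (-(i + 1))) fun i ↦ -Real.exp (-(i + 1))) fun _ ↦ 0

/-- The skew-adjoint matrix coupling the positive to the negative lacunary eigenvalues by the
discrete Hilbert matrix. -/
noncomputable def skewHilbertMatrix (n : ℕ) :
    Matrix ((Fin n ⊕ Fin n) ⊕ Unit) ((Fin n ⊕ Fin n) ⊕ Unit) ℂ :=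
  fromBlocks (fromBlocks 0 ((discreteHilbertMatrix n).map Complex.ofReal)
    (-((discreteHilbertMatrix n).map Complex.ofReal)ᴴ) 0) 0 0 0

theorem lacunaryEigenvalues_mem_Icc (n : ℕ) (a : (Fin n ⊕ Fin n) ⊕ Unit) :
    lacunaryEigenvalues n a ∈ Set.Icc (-(Real.exp 1)⁻¹) (Real.exp 1)⁻¹ := by
  have hle (k : ℕ) : Real.exp (-(k + 1)) ≤ (Real.exp 1)⁻¹ := by
    rw [← Real.exp_neg]
    gcongr
    simp
  have hpos := (Real.exp_pos 1).le
  rw [Set.mem_Icc, ← abs_le]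
  obtain (i | i) | _ := a <;> simp [lacunaryEigenvalues, -neg_add_rev, hle, hpos]

theorem conjTranspose_skewHilbertMatrix (n : ℕ) :
    (skewHilbertMatrix n)ᴴ = -skewHilbertMatrix n := by
  simp [skewHilbertMatrix, fromBlocks_conjTranspose, fromBlocks_neg]

theorem skewHilbertMatrix_apply_eq_zero {n : ℕ} (a b : (Fin n ⊕ Fin n) ⊕ Unit)
    (hab : lacunaryEigenvalues n a = lacunaryEigenvalues n b) : skewHilbertMatrix n a b = 0 := by
  have hne (i j : ℕ) : Real.exp (-(i + 1)) ≠ -Real.exp (-(j + 1)) :=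
    ((neg_lt_zero.2 (Real.exp_pos _)).trans (Real.exp_pos _)).ne'
  obtain (i | i) | _ := a <;> obtain (j | j) | _ := b
  case inl.inl.inl.inr => exact absurd hab (hne i j)
  case inl.inr.inl.inl => exact absurd hab.symm (hne j i)
  all_goals simp [skewHilbertMatrix]

theorem norm_skewHilbertMatrix_le_one (n : ℕ) : ‖skewHilbertMatrix n‖ ≤ 1 := by
  have hunit := discreteHilbertMatrix_mem_unitaryGroup n
  have hG : (skewHilbertMatrix n)ᴴ * skewHilbertMatrix n =
      diagonal (Sum.elim (fun _ ↦ 1) fun _ ↦ 0) := by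
    have h₁ := mem_unitaryGroup_iff.1 hunit
    have h₂ := mem_unitaryGroup_iff'.1 hunit
    rw [star_eq_conjTranspose] at h₁ h₂
    simp [skewHilbertMatrix, fromBlocks_conjTranspose, fromBlocks_multiply, h₁, h₂,
      ← fromBlocks_diagonal, fromBlocks_one]
  rw [← abs_norm, ← sq_le_one_iff_abs_le_one, sq, ← l2_opNorm_conjTranspose_mul_self, hG,
    l2_opNorm_diagonal, pi_norm_le_iff_of_nonneg zero_le_one]
  rintro (a | a) <;> simp

theorem le_norm_loewnerMatrix_hadamard_skewHilbertMatrix {n : ℕ} (hn : 0 < n) :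
    2 / (9 * Real.pi) * √(Real.log n) ≤
      ‖loewnerMatrix hFormula (lacunaryEigenvalues n) ⊙ skewHilbertMatrix n‖ := by
  set L := loewnerMatrix hFormula (lacunaryEigenvalues n) ⊙ skewHilbertMatrix n
  let entry (i j : Fin n) : ℝ :=
    slope hFormula (Real.exp (-(i + 1))) (-Real.exp (-(j + 1))) * discreteHilbertMatrix n i j
  have hL : ‖∑ i, ∑ j, (entry i j : ℂ)‖ ≤ n * ‖L‖ := by
    have hle := norm_sum_sum_apply_le L (Finset.univ.map (.trans .inl .inl))
      (Finset.univ.map (.trans .inr .inl))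
    simpa [L, entry, loewnerMatrix, lacunaryEigenvalues, skewHilbertMatrix] using hle
  have hrow (i : Fin n) : 2 / (9 * Real.pi) * √(Real.log n) ≤ ∑ j, entry i j :=
    calc 2 / (9 * Real.pi) * √(Real.log n)
        = 2 / (9 * Real.pi) * (√(Real.log n))⁻¹ * Real.log n := by
          rw [mul_assoc, inv_mul_eq_div, Real.div_sqrt]
      _ ≤ 2 / (9 * Real.pi) * (√(Real.log n))⁻¹ * ∑ j ∈ Finset.range n, |(j - i : ℝ)|⁻¹ := by
          gcongr
          exact log_le_sum_inv_abs_sub i.is_lt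
      _ = ∑ j : Fin n, 2 / (9 * Real.pi) * (√(Real.log n))⁻¹ * |(j - i : ℝ)|⁻¹ := by
          rw [← Fin.sum_univ_eq_sum_range fun j ↦ |(j - i : ℝ)|⁻¹, Finset.mul_sum]
      _ ≤ ∑ j, entry i j :=
          Finset.sum_le_sum fun j _ ↦ le_slope_hFormula_mul_discreteHilbertMatrix i j
  refine le_of_mul_le_mul_left ?_ (Nat.cast_pos.2 hn : (0 : ℝ) < n)
  calc n * (2 / (9 * Real.pi) * √(Real.log n)) ≤ ∑ i, ∑ j, entry i j := by
        simpa using Finset.card_nsmul_le_sum Finset.univ _ _ fun i _ ↦ hrow i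
    _ ≤ ‖∑ i, ∑ j, (entry i j : ℂ)‖ := by
        simp only [← Complex.ofReal_sum, Complex.norm_real]
        exact Real.le_norm_self _
    _ ≤ n * ‖L‖ := hL

theorem mul_norm_skewHilbertMatrix_lt {n : ℕ} (hn : 2 ≤ n) :
    1 / (9 * Real.pi) * √(Real.log n) * ‖skewHilbertMatrix n‖ <
      ‖loewnerMatrix hFormula (lacunaryEigenvalues n) ⊙ skewHilbertMatrix n‖ := by
  have hlog : 0 < √(Real.log n) := Real.sqrt_pos.2 (Real.log_pos (mod_cast hn))
  calc 1 / (9 * Real.pi) * √(Real.log n) * ‖skewHilbertMatrix n‖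
      ≤ 1 / (9 * Real.pi) * √(Real.log n) :=
        mul_le_of_le_one_right (by positivity) (norm_skewHilbertMatrix_le_one n)
    _ < 2 / (9 * Real.pi) * √(Real.log n) := by gcongr; norm_num
    _ ≤ _ := le_norm_loewnerMatrix_hadamard_skewHilbertMatrix (by omega)

/-- Matrices over an index type with `N` elements, as operators on `ℓ²_N`. -/
noncomputable def matrixEquivOpL2 {ι : Type*} [Fintype ι] [DecidableEq ι] {N : ℕ}
    (e : ι ≃ Fin N) : Matrix ι ι ℂ ≃⋆ₐ[ℂ] OpL2 N :=
  (StarAlgEquiv.ofAlgEquiv (Matrix.reindexAlgEquiv ℂ ℂ e) fun M ↦ by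
    ext; simp [star_apply]).trans (Matrix.toEuclideanCLM (n := Fin N) (𝕜 := ℂ))

end LacunaryOperators

theorem theorem4p1_general :
    ∃ c : ℝ, 0 < c ∧
      ∀ n : ℕ, 2 ≤ n →
        ∃ A B : OpL2 (2 * n + 1),
          IsSelfAdjoint A ∧ IsSelfAdjoint B ∧ B ≠ 0 ∧
          (0 : ℂ) ∈ spectrum ℂ A ∧
          (∀ h : ℝ → ℝ, Set.EqOn h hFormula (Set.Icc (-(Real.exp 1)⁻¹) (Real.exp 1)⁻¹) →
            c * (Real.log n) ^ (1 / 2 : ℝ) * ‖B‖ ≤ ‖cfc h (A + B) - cfc h A‖) ∧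
          ∃ S : unitary (OpL2 (2 * n + 1)),
            A + B = ((S⁻¹ : unitary (OpL2 (2 * n + 1))) : OpL2 (2 * n + 1)) * A *
              (S : OpL2 (2 * n + 1)) := by
  refine ⟨1 / (9 * Real.pi), by positivity, fun n hn ↦ ?_⟩
  rw [← Real.sqrt_eq_rpow]
  let φ : Matrix _ _ ℂ ≃⋆ₐ[ℂ] OpL2 (2 * n + 1) := matrixEquivOpL2 <| Fintype.equivFinOfCardEq <|
    show Fintype.card ((Fin n ⊕ Fin n) ⊕ Unit) = 2 * n + 1 by simp [two_mul]
  let D := Matrix.diagonal fun a ↦ (lacunaryEigenvalues n a : ℂ)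
  have hA : IsSelfAdjoint (φ D) :=
    IsSelfAdjoint.map (Matrix.isHermitian_diagonal_of_self_adjoint _
      (isSelfAdjoint_ofReal_comp _)) φ
  have h₀ : (0 : ℂ) ∈ spectrum ℂ (φ D) := by
    rw [AlgEquiv.spectrum_eq φ, spectrum_diagonal]
    exact ⟨Sum.inr (), by simp [lacunaryEigenvalues]⟩
  obtain ⟨B, hB, hB₀, hlt, hS⟩ := exists_perturbation_of_mul_norm_lt_norm_loewnerMatrix_hadamard
    (φ := (φ : Matrix _ _ ℂ →⋆ₐ[ℂ] OpL2 (2 * n + 1))) φ.injective hFormula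
    (conjTranspose_skewHilbertMatrix n) skewHilbertMatrix_apply_eq_zero
    (mul_norm_skewHilbertMatrix_lt hn) rfl
  exact ⟨φ D, B, hA, hB, hB₀, h₀,
    fun h hh ↦ (hlt h fun r ⟨a, ha⟩ ↦ hh (ha ▸ lacunaryEigenvalues_mem_Icc n a)).le, hS⟩

theorem theorem4p1 :
    ∃ c : ℝ, 0 < c ∧
      ∀ h : ℝ → ℝ, IsPeriodicExtension h →
        ∀ n : ℕ, 3 ≤ n →
          ∃ A B : OpL2 (2 * n + 1),
            IsSelfAdjoint A ∧ IsSelfAdjoint B ∧ B ≠ 0 ∧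
            (0 : ℂ) ∈ spectrum ℂ A ∧
            c * (Real.log n) ^ (1 / 2 : ℝ) * ‖B‖ ≤ ‖cfc h (A + B) - cfc h A‖ ∧
            ∃ S : unitary (OpL2 (2 * n + 1)),
              A + B = ((S⁻¹ : unitary (OpL2 (2 * n + 1))) : OpL2 (2 * n + 1)) * A *
                (S : OpL2 (2 * n + 1)) := by
  obtain ⟨c, hc, hAB⟩ := theorem4p1_general
  refine ⟨c, hc, fun h hh n hn ↦ ?_⟩
  obtain ⟨A, B, hA, hB, hB₀, h₀, hle, hS⟩ := hAB n (by omega)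
  exact ⟨A, B, hA, hB, hB₀, h₀, hle h hh.eqOn, hS⟩
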